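/- A first-kind Abel equation $\mathcal{E}$ is an equation $y'=a(x)y^3+b(x)y^2+c(x)y+d(x)$ whose coefficients are $C^\infty$ on an open interval of $\mathbb{R}$, with $a\neq0$ there. Put $$s_1=a,\qquad s_3=a'b-b'a+abc-\tfrac29b^3-3a^2d,\qquad s_5=a\,s_3'-3s_3\bigl(a'+ac-\tfrac13b^2\bigr),$$ $$J_1=\frac{s_5^3}{s_3^5},\qquad \nabla=\frac{s_1}{s_3^{2/3}}\,\frac{d}{dx}\quad\bigl(s_3^{2/3}=|s_3|^{2/3}\bigr),$$ let $\sigma_{\mathcal{E}}(x)=\bigl(J_1(x),(\nabla J_1)(x)\bigr)\in\mathbb{R}^2$, and let $j_1,j_{11}$ be the coordinates on $\mathbb{R}^2$. For an open interval $\Delta$ in the domain of $\mathcal{E}$ put $\Sigma_{\mathcal{E}}=\sigma_{\mathcal{E}}(\Delta)$. We call $\mathcal{E}$ regular on $\Delta$ if $s_1s_3\neq0$ on $\Delta$, $\Sigma_{\mathcal{E}}$ is a smooth (embedded) curve in $\mathbb{R}^2$, and near each point of $\Sigma_{\mathcal{E}}$ one of the functions $j_1,j_{11}$ is a local coordinate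 on $\Sigma_{\mathcal{E}}$. For points $x_0,\bar x_0$, we say that $\mathcal{E}$ near $x_0$ is $G$-equivalent to $\overline{\mathcal{E}}$ near $\bar x_0$ if there are $C^\infty$ functions $f,g,h$ on an open interval around $x_0$, with $f'$ and $g$ nowhere zero and $f(x_0)=\bar x_0$, such that the transformation $x\mapsto f(x)$, $y\mapsto g(x)y+h(x)$ carries $\mathcal{E}$ to $\overline{\mathcal{E}}$. Two equations $\mathcal{E}$ on $\Delta$ and $\overline{\mathcal{E}}$ on $\overline{\Delta}$ are locally $G$-equivalent if each of them is, near every point of its interval, $G$-equivalent to the other one near some point of the other interval. Theorem 3. Let $\mathcal{E}$ be regular on $\Delta$ and $\overline{\mathcal{E}}$ regular on $\overline{\Delta}$. Then $\mathcal{E}$ and $\overline{\mathcal{E}}$ are locally $G$-equivalent if and only if $\Sigma_{\mathcal{E}}=\Sigma_{\overline{\mathcal{E}}}$. Moreover, for given points $x_0\in\Delta$ and $\bar x_0\in\overline{\Delta}$, $\mathcal{E}$ near $x_0$ is $G$-equivalent to $\overline{\mathcal{E}}$ near $\bar x_0$ if and only if $\sigma_{\mathcal{E}}(x_0)=\sigma_{\overline{\mathcal{E}}}(\bar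 x_0)$ and $\Sigma_{\mathcal{E}}$ and $\Sigma_{\overline{\mathcal{E}}}$ coincide in a neighbourhood of this point. -/

import Mathlib

open scoped ContDiff

noncomputable section

/-- A nonempty open interval of the real line (possibly unbounded). -/
def IsOpenInterval (D : Set ℝ) : Prop :=
  IsOpen D ∧ D.OrdConnected ∧ D.Nonempty

/-- A first-kind Abel equation `y' = a(x) y^3 + b(x) y^2 + c(x) y + d(x)` with smooth coefficients
on an open interval `dom` and `a ≠ 0` there. The values of the coefficients outside `dom` carry
no meaning. -/
structure AbelODE where
  dom : Set ℝ
  a : ℝ → ℝ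
  b : ℝ → ℝ
  c : ℝ → ℝ
  d : ℝ → ℝ
  isOpenInterval_dom : IsOpenInterval dom
  smooth_a : ContDiffOn ℝ ∞ a dom
  smooth_b : ContDiffOn ℝ ∞ b dom
  smooth_c : ContDiffOn ℝ ∞ c dom
  smooth_d : ContDiffOn ℝ ∞ d dom
  a_ne_zero : ∀ x ∈ dom, a x ≠ 0

/-- `φ` (a function on the plane) is a local coordinate on the curve `S` near the point `p`:
near `p` it maps `S` bijectively onto an open interval, with smooth inverse `γ`. -/
def IsLocalCoordinateAt (φ : ℝ × ℝ → ℝ) (S : Set (ℝ × ℝ)) (p : ℝ × ℝ) : Prop :=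
  ∃ (U : Set (ℝ × ℝ)) (I : Set ℝ) (γ : ℝ → ℝ × ℝ),
    IsOpen U ∧ p ∈ U ∧ IsOpenInterval I ∧ ContDiffOn ℝ ∞ γ I ∧
    (∀ q ∈ S ∩ U, φ q ∈ I ∧ γ (φ q) = q) ∧
    (∀ t ∈ I, γ t ∈ S ∩ U ∧ φ (γ t) = t)

/-- `S` is a smooth curve in the plane, i.e. a nonempty embedded one-dimensional smooth
submanifold: locally it is the zero set of a smooth function with nonvanishing differential. -/
def IsSmoothCurve (S : Set (ℝ × ℝ)) : Prop :=
  S.Nonempty ∧ ∀ p ∈ S, ∃ (U : Set (ℝ × ℝ)) (G : ℝ × ℝ → ℝ),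
    IsOpen U ∧ p ∈ U ∧ ContDiffOn ℝ ∞ G U ∧
    (∀ q ∈ U, G q = 0 → fderiv ℝ G q ≠ 0) ∧
    S ∩ U = {q | q ∈ U ∧ G q = 0}

namespace AbelODE

/-- The right-hand side of the equation. -/
def rhs (E : AbelODE) (x y : ℝ) : ℝ :=
  E.a x * y ^ 3 + E.b x * y ^ 2 + E.c x * y + E.d x

/-- The relative invariant `s₁ = a`. -/
def s1 (E : AbelODE) (x : ℝ) : ℝ := E.a x

/-- The relative invariant `s₃ = a'b - b'a + abc - (2/9) b^3 - 3 a^2 d`. -/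
def s3 (E : AbelODE) (x : ℝ) : ℝ :=
  deriv E.a x * E.b x - deriv E.b x * E.a x + E.a x * E.b x * E.c x
    - 2 / 9 * E.b x ^ 3 - 3 * E.a x ^ 2 * E.d x

/-- The relative invariant `s₅ = a s₃' - 3 s₃ (a' + ac - b^2/3)`. -/
def s5 (E : AbelODE) (x : ℝ) : ℝ :=
  E.a x * deriv E.s3 x
    - 3 * E.s3 x * (deriv E.a x + E.a x * E.c x - 1 / 3 * E.b x ^ 2)

/-- The absolute invariant `J₁ = s₅^3 / s₃^5` evaluated on `E`. -/
def J1 (E : AbelODE) (x : ℝ) : ℝ := E.s5 x ^ 3 / E.s3 x ^ 5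

/-- The invariant derivation `∇ = s₁ / s₃^(2/3) d/dx` evaluated on `E`; the real number
`s₃^(2/3)`, the square of the real cube root of `s₃`, is `|s₃|^(2/3)`. -/
def nabla (E : AbelODE) (F : ℝ → ℝ) (x : ℝ) : ℝ :=
  E.s1 x / |E.s3 x| ^ (2 / 3 : ℝ) * deriv F x

/-- The map `x ↦ (j₁, j₁₁) = (J₁, ∇ J₁)`, evaluated on `E`. -/
def sigmaMap (E : AbelODE) (x : ℝ) : ℝ × ℝ := (E.J1 x, E.nabla E.J1 x)

/-- The image of the open interval `Δ` under `x ↦ (J₁, ∇ J₁)`. -/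
def sigmaCurve (E : AbelODE) (Δ : Set ℝ) : Set (ℝ × ℝ) := E.sigmaMap '' Δ

/-- `E` is regular on the open interval `Δ`: `s₁ s₃ ≠ 0` on `Δ`, the image of `Δ` is a smooth
curve, and near each of its points `j₁` or `j₁₁` is a local coordinate on it. -/
structure RegularOn (E : AbelODE) (Δ : Set ℝ) : Prop where
  isOpenInterval : IsOpenInterval Δ
  subset_dom : Δ ⊆ E.dom
  s1_mul_s3_ne_zero : ∀ x ∈ Δ, E.s1 x * E.s3 x ≠ 0
  smoothCurve : IsSmoothCurve (E.sigmaCurve Δ)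
  localCoordinate : ∀ p ∈ E.sigmaCurve Δ,
    IsLocalCoordinateAt Prod.fst (E.sigmaCurve Δ) p ∨
      IsLocalCoordinateAt Prod.snd (E.sigmaCurve Δ) p

/-- The transformation `x ↦ f(x)`, `y ↦ g(x) y + h(x)` over the open interval `D`, with `f'` and
`g` nowhere zero, carries `E₁` over `D` to `E₂` over `f(D)`: its first prolongation
`(x, y, p) ↦ (f, g y + h, (g' y + g p + h') / f')` maps the surface `p = rhs₁(x, y)` onto the
surface `p = rhs₂(x, y)`. -/
structure Carries (f g h : ℝ → ℝ) (D : Set ℝ) (E₁ E₂ : AbelODE) : Prop where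
  isOpenInterval : IsOpenInterval D
  subset_dom : D ⊆ E₁.dom
  mapsTo_dom : Set.MapsTo f D E₂.dom
  smooth_f : ContDiffOn ℝ ∞ f D
  smooth_g : ContDiffOn ℝ ∞ g D
  smooth_h : ContDiffOn ℝ ∞ h D
  deriv_f_ne_zero : ∀ x ∈ D, deriv f x ≠ 0
  g_ne_zero : ∀ x ∈ D, g x ≠ 0
  map_eq : ∀ x ∈ D, ∀ y p : ℝ, p = E₁.rhs x y ↔
    (deriv g x * y + g x * p + deriv h x) / deriv f x = E₂.rhs (f x) (g x * y + h x)

/-- `E₁` near `x₁` is equivalent to `E₂` near `x₂` under the pseudogroup of transformations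
`x ↦ f(x)`, `y ↦ g(x) y + h(x)`. -/
def EquivalentAt (E₁ : AbelODE) (x₁ : ℝ) (E₂ : AbelODE) (x₂ : ℝ) : Prop :=
  ∃ (D : Set ℝ) (f g h : ℝ → ℝ), x₁ ∈ D ∧ f x₁ = x₂ ∧ Carries f g h D E₁ E₂

/-- Local equivalence of `E₁` over `Δ₁` with `E₂` over `Δ₂`: each of the two equations is, near
every point of its interval, equivalent to the other one near some point of the other interval. -/
def LocallyEquivalent (E₁ : AbelODE) (Δ₁ : Set ℝ) (E₂ : AbelODE) (Δ₂ : Set ℝ) : Prop :=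
  (∀ x₁ ∈ Δ₁, ∃ x₂ ∈ Δ₂, EquivalentAt E₁ x₁ E₂ x₂) ∧
  (∀ x₂ ∈ Δ₂, ∃ x₁ ∈ Δ₁, EquivalentAt E₁ x₁ E₂ x₂)

end AbelODE

end

/-! Necessity. Comparing coefficients of `y` shows that a transformation multiplies `s1`, `s3`, `s5`
by `g² f'`, `(g f')³`, `(g f')⁵`. Hence `J1` and `∇` are invariant, and σ₁ = σ₂ ∘ f.

Sufficiency. The crux is that σ is an immersion, although regularity constrains only its image. If
`j₁₁ = G(j₁)` along the curve, then `∇ J1 = G(J1)` is a first-order ODE, so a critical point of `J1`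
is an equilibrium and `J1` is constant near it. If `j₁ = G(j₁₁)`, a similar argument applies. By
connectedness σ would be constant on the interval, which a local coordinate excludes
(`deriv_comp_ne_zero_of_eventually_const`). So where the curves coincide, the inverse function
theorem gives a smooth `f` with σ₁ = σ₂ ∘ f (`exists_reparametrization`).

Equality of the second components forces `f` to match the two derivations. Then `g` is found from
`a` and `s3`, `h` from `b`, and the rules for `c` and `d` follow because `s5` is affine in `c` and
`s3` is affine in `d` (`exists_carries`). -/

section

open Filter Topology Set

/-! ### Pointwise identities for the relative invariants -/

/-- The covariant derivative relations of the first three coefficients determine how `s₃` changes. -/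
theorem abel_s3_transform {a a' b b' c d A A' B B' C D F F' g g' h h' : ℝ}
    (ha : a = A * g ^ 2 * F)
    (ha' : a' = A' * F * g ^ 2 * F + A * (2 * g * g' * F + g ^ 2 * F'))
    (hb : b = F * g * (3 * A * h + B))
    (hb' : b' = F' * g * (3 * A * h + B) + F * g' * (3 * A * h + B)
      + F * g * (3 * (A' * F) * h + 3 * A * h' + B' * F))
    (hc : g' + g * c = F * (3 * A * g * h ^ 2 + 2 * B * g * h + C * g))
    (hd : h' + g * d = F * (A * h ^ 3 + B * h ^ 2 + C * h + D)) :
    a' * b - b' * a + a * b * c - 2 / 9 * b ^ 3 - 3 * a ^ 2 * d =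
      (g * F) ^ 3 * (A' * B - B' * A + A * B * C - 2 / 9 * B ^ 3 - 3 * A ^ 2 * D) := by
  have hg' : g' = F * (3 * A * g * h ^ 2 + 2 * B * g * h + C * g) - g * c := by linarith
  have hh' : h' = F * (A * h ^ 3 + B * h ^ 2 + C * h + D) - g * d := by linarith
  subst hg' hh' ha ha' hb hb'
  ring

/-- Neither `d` nor its rule enters, so `c` can later be recovered from `s5` before `d` is known. -/
theorem abel_s5_transform {a a' b c s s' A A' B C S S' F F' g g' h : ℝ}
    (ha : a = A * g ^ 2 * F)
    (ha' : a' = A' * F * g ^ 2 * F + A * (2 * g * g' * F + g ^ 2 * F'))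
    (hb : b = F * g * (3 * A * h + B))
    (hc : g' + g * c = F * (3 * A * g * h ^ 2 + 2 * B * g * h + C * g))
    (hs : s = (g * F) ^ 3 * S)
    (hs' : s' = 3 * (g * F) ^ 2 * (g' * F + g * F') * S + (g * F) ^ 3 * (S' * F)) :
    a * s' - 3 * s * (a' + a * c - 1 / 3 * b ^ 2) =
      (g * F) ^ 5 * (A * S' - 3 * S * (A' + A * C - 1 / 3 * B ^ 2)) := by
  have hg' : g' = F * (3 * A * g * h ^ 2 + 2 * B * g * h + C * g) - g * c := by linarith
  subst hg' ha ha' hb hs hs'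
  ring

/-- Two cubic polynomials agree as functions iff their coefficients agree. -/
theorem cubic_coeff_eq {p₀ p₁ p₂ p₃ q₀ q₁ q₂ q₃ : ℝ}
    (h : ∀ y : ℝ, p₃ * y ^ 3 + p₂ * y ^ 2 + p₁ * y + p₀ = q₃ * y ^ 3 + q₂ * y ^ 2 + q₁ * y + q₀) :
    p₃ = q₃ ∧ p₂ = q₂ ∧ p₁ = q₁ ∧ p₀ = q₀ := by
  have h0 := h 0
  have h1 := h 1
  have h2 := h (-1)
  have h3 := h 2
  norm_num at h0 h1 h2 h3
  refine ⟨?_, ?_, ?_, ?_⟩ <;> linarith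

/-! ### Uniqueness for first-order differential relations -/

/-- A function vanishing at `x` whose derivative is bounded by a multiple of it vanishes
near `x`. -/
theorem eventually_eq_zero_of_abs_deriv_le {w : ℝ → ℝ} {x K : ℝ}
    (hw : ∀ᶠ y in 𝓝 x, DifferentiableAt ℝ w y) (h0 : w x = 0)
    (hb : ∀ᶠ y in 𝓝 x, |deriv w y| ≤ K * |w y|) : ∀ᶠ y in 𝓝 x, w y = 0 := by
  obtain ⟨ε, hε, h⟩ := Metric.eventually_nhds_iff.1 (hw.and hb)
  have hR : ∀ y ∈ Icc x (x + ε / 2), w y = 0 := by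
    have hm : ∀ y ∈ Icc x (x + ε / 2), dist y x < ε := fun y hy => by
      rw [Real.dist_eq, abs_lt]; constructor <;> linarith [hy.1, hy.2]
    refine eq_zero_of_abs_deriv_le_mul_abs_self_of_eq_zero_right (f' := deriv w) (K := K)
      (fun y hy => (h (hm y hy)).1.continuousAt.continuousWithinAt)
      (fun y hy => (h (hm y (Ico_subset_Icc_self hy))).1.hasDerivAt.hasDerivWithinAt) h0
      (fun y hy => (h (hm y (Ico_subset_Icc_self hy))).2)
  -- The Grönwall estimate is one-sided; the left half follows by the reflection `y ↦ -y`.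
  have hL : ∀ y ∈ Icc (-x) (-x + ε / 2), w (-y) = 0 := by
    have hm : ∀ y ∈ Icc (-x) (-x + ε / 2), dist (-y) x < ε := fun y hy => by
      rw [Real.dist_eq, abs_lt]; constructor <;> linarith [hy.1, hy.2]
    have hd : ∀ y ∈ Icc (-x) (-x + ε / 2), HasDerivAt (fun z => w (-z)) (-deriv w (-y)) y :=
      fun y hy => by
        have := (h (hm y hy)).1.hasDerivAt.comp y (hasDerivAt_neg y)
        rwa [mul_neg_one] at this
    refine eq_zero_of_abs_deriv_le_mul_abs_self_of_eq_zero_right (f' := fun y => -deriv w (-y))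
      (K := K) (fun y hy => (hd y hy).continuousAt.continuousWithinAt)
      (fun y hy => (hd y (Ico_subset_Icc_self hy)).hasDerivWithinAt) (by simpa using h0)
      (fun y hy => by simpa using (h (hm y (Ico_subset_Icc_self hy))).2)
  refine Metric.eventually_nhds_iff.2 ⟨ε / 2, by linarith, fun y hy => ?_⟩
  rw [Real.dist_eq, abs_lt] at hy
  rcases le_total x y with hxy | hxy
  · exact hR y ⟨hxy, by linarith⟩
  · simpa using hL (-y) ⟨by linarith, by linarith⟩

/-- If `v = τ J'` is a differentiable function of `J`, then a zero of `v` is interior to a level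
set of `J`. -/
theorem eventually_const_of_deriv_eq_comp {J v τ G : ℝ → ℝ} {x : ℝ}
    (hJ : ∀ᶠ y in 𝓝 x, DifferentiableAt ℝ J y) (hτ : ContinuousAt τ x) (hτ0 : τ x ≠ 0)
    (hv : ∀ᶠ y in 𝓝 x, v y = τ y * deriv J y) (hG : DifferentiableAt ℝ G (J x))
    (hvG : ∀ᶠ y in 𝓝 x, v y = G (J y)) (h0 : v x = 0) : ∀ᶠ y in 𝓝 x, J y = J x := by
  have hJc : ContinuousAt J x := hJ.self_of_nhds.continuousAt
  have hG0 : G (J x) = 0 := hvG.self_of_nhds.symm.trans h0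
  obtain ⟨C, hC⟩ := hG.isBigO_sub.bound
  have hC := hJc.eventually hC
  have hinv : ∀ᶠ y in 𝓝 x, |(τ y)⁻¹| < |(τ x)⁻¹| + 1 :=
    (hτ.inv₀ hτ0).abs.eventually_lt continuousAt_const (by simp)
  -- `J' = τ⁻¹ (G(J) - G(J x))` since `G(J x) = 0`; differentiability of `G` at this one point
  -- bounds the difference by `C |J - J x|`.
  have key : ∀ᶠ y in 𝓝 x, J y - J x = 0 := by
    refine eventually_eq_zero_of_abs_deriv_le (K := (|(τ x)⁻¹| + 1) * C)
      (hJ.mono fun y hy => hy.sub_const _) (by simp) ?_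
    filter_upwards [hv, hvG, hC, hinv, hτ.eventually_ne hτ0] with y h1 h2 h3 h4 h5
    rw [hG0, sub_zero] at h3
    have : deriv J y = (τ y)⁻¹ * G (J y) := by rw [← h2, h1]; field_simp
    simp only [deriv_sub_const_fun, this, abs_mul, Real.norm_eq_abs] at h3 ⊢
    rw [mul_assoc]
    exact mul_le_mul h4.le h3 (abs_nonneg _) (by positivity)
  exact key.mono fun y hy => sub_eq_zero.1 hy

/-- If `J` is a smooth function of `v = τ J'`, then a zero of both `v` and `v'` is interior to the
zero set of `v`. -/
theorem eventually_eq_zero_of_eq_comp {J v τ G : ℝ → ℝ} {x : ℝ}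
    (hv' : ∀ᶠ y in 𝓝 x, DifferentiableAt ℝ v y) (hvc : ContinuousAt (deriv v) x)
    (hτ : ContinuousAt τ x) (hτ0 : τ x ≠ 0)
    (hv : ∀ᶠ y in 𝓝 x, v y = τ y * deriv J y)
    (hG : ∀ᶠ z in 𝓝 (v x), DifferentiableAt ℝ G z) (hG' : DifferentiableAt ℝ (deriv G) (v x))
    (hJG : ∀ᶠ y in 𝓝 x, J y = G (v y)) (h0 : v x = 0) (h1 : deriv v x = 0) :
    ∀ᶠ y in 𝓝 x, v y = 0 := by
  have hc : ContinuousAt v x := hv'.self_of_nhds.continuousAt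
  have hrel : ∀ᶠ y in 𝓝 x, v y = τ y * (deriv G (v y) * deriv v y) := by
    filter_upwards [hv, hv', hc.eventually hG, hJG.eventually_nhds] with y e1 e2 e3 e4
    have : deriv J y = deriv G (v y) * deriv v y := by
      rw [EventuallyEq.deriv_eq e4]
      exact (e3.hasDerivAt.comp y e2.hasDerivAt).deriv
    exact e1.trans (by rw [this])
  have hGc : ContinuousAt (fun y => deriv G (v y)) x := hG'.continuousAt.comp hc
  by_cases hd : deriv G (v x) = 0
  -- Degenerate case `G'(0) = 0`: then `G'(v) = O(v)`, so `v = τ G'(v) v'` gives `|v| ≤ ε |v|` with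
  -- `ε < 1`, because `v'` is small near `x`.
  · obtain ⟨C, hC⟩ := hG'.isBigO_sub.bound
    have hC := hc.eventually hC
    have hsmall : ∀ᶠ y in 𝓝 x, |τ y| * C * |deriv v y| < 1 := by
      have : ContinuousAt (fun y => |τ y| * C * |deriv v y|) x :=
        (hτ.abs.mul continuousAt_const).mul hvc.abs
      exact this.eventually_lt continuousAt_const (by simp [h1])
    filter_upwards [hrel, hC, hsmall] with y e1 e2 e3
    rw [hd, h0, sub_zero, sub_zero, Real.norm_eq_abs, Real.norm_eq_abs] at e2
    by_contra hne
    have hpos : 0 < |v y| := abs_pos.2 hne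
    have : |v y| ≤ |τ y| * C * |deriv v y| * |v y| := by
      calc |v y| = |τ y| * |deriv v y| * |deriv G (v y)| := by
            conv_lhs => rw [e1]
            simp only [abs_mul]; ring
        _ ≤ |τ y| * |deriv v y| * (C * |v y|) := by gcongr
        _ = _ := by ring
    nlinarith
  -- If `G'(0) ≠ 0`, the relation can be solved as `v' = v / (τ G'(v))`, a linear bound on `v'`.
  · have hne : ∀ᶠ y in 𝓝 x, deriv G (v y) ≠ 0 := hGc.eventually_ne hd
    have hinv : ∀ᶠ y in 𝓝 x, |(τ y * deriv G (v y))⁻¹| < |(τ x * deriv G (v x))⁻¹| + 1 :=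
      ((hτ.mul hGc).inv₀ (mul_ne_zero hτ0 hd)).abs.eventually_lt continuousAt_const (by simp)
    refine eventually_eq_zero_of_abs_deriv_le (K := |(τ x * deriv G (v x))⁻¹| + 1) hv' h0 ?_
    filter_upwards [hrel, hne, hinv, hτ.eventually_ne hτ0] with y e1 e2 e3 e4
    have : deriv v y = (τ y * deriv G (v y))⁻¹ * v y := by
      rw [eq_inv_mul_iff_mul_eq₀ (mul_ne_zero e4 e2), mul_assoc]
      exact e1.symm
    rw [this, abs_mul]
    gcongr

/-! ### Smoothness of the invariants -/

namespace AbelODE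

/-- The coefficient `s₁ / |s₃|^(2/3)` of the invariant derivation. -/
noncomputable def weight (E : AbelODE) (x : ℝ) : ℝ := E.s1 x / |E.s3 x| ^ (2 / 3 : ℝ)

theorem isOpen_dom (E : AbelODE) : IsOpen E.dom := E.isOpenInterval_dom.1

theorem contDiffOn_s3 (E : AbelODE) : ContDiffOn ℝ ∞ E.s3 E.dom := by
  have ha := E.smooth_a
  have hb := E.smooth_b
  have hc := E.smooth_c
  have hd := E.smooth_d
  have ha' := ha.deriv_of_isOpen E.isOpen_dom (m := ∞) (by simp)
  have hb' := hb.deriv_of_isOpen E.isOpen_dom (m := ∞) (by simp)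
  unfold s3
  fun_prop

theorem contDiffOn_s5 (E : AbelODE) : ContDiffOn ℝ ∞ E.s5 E.dom := by
  have ha := E.smooth_a
  have hb := E.smooth_b
  have hc := E.smooth_c
  have hs := E.contDiffOn_s3
  have ha' := ha.deriv_of_isOpen E.isOpen_dom (m := ∞) (by simp)
  have hs' := hs.deriv_of_isOpen E.isOpen_dom (m := ∞) (by simp)
  unfold s5
  fun_prop

/-- Cubing removes the fractional power, leaving a relation that is rational in the invariants. -/
theorem weight_cube {E : AbelODE} {x : ℝ} (h : E.s3 x ≠ 0) :
    E.weight x ^ 3 * E.s3 x ^ 2 = E.a x ^ 3 := by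
  have h1 : (|E.s3 x| ^ (2 / 3 : ℝ)) ^ 3 = E.s3 x ^ 2 := by
    rw [← Real.rpow_natCast, ← Real.rpow_mul (abs_nonneg _)]
    norm_num
  have : E.s3 x ^ 2 ≠ 0 := pow_ne_zero _ h
  rw [weight, div_pow, h1, s1]
  field_simp

theorem nabla_eq (E : AbelODE) (F : ℝ → ℝ) (x : ℝ) : E.nabla F x = E.weight x * deriv F x := rfl

/-! ### The map σ of a regular equation is an immersion -/

namespace RegularOn

variable {E : AbelODE} {Δ : Set ℝ}

theorem isOpen (h : E.RegularOn Δ) : IsOpen Δ := h.isOpenInterval.1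

theorem s3_ne_zero (h : E.RegularOn Δ) {x : ℝ} (hx : x ∈ Δ) : E.s3 x ≠ 0 :=
  right_ne_zero_of_mul (h.s1_mul_s3_ne_zero x hx)

theorem weight_ne_zero (h : E.RegularOn Δ) {x : ℝ} (hx : x ∈ Δ) : E.weight x ≠ 0 :=
  div_ne_zero (left_ne_zero_of_mul (h.s1_mul_s3_ne_zero x hx))
    (Real.rpow_pos_of_pos (abs_pos.2 (h.s3_ne_zero hx)) _).ne'

theorem contDiffOn_weight (h : E.RegularOn Δ) : ContDiffOn ℝ ∞ E.weight Δ := by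
  intro x hx
  have h3 := E.contDiffOn_s3.contDiffAt (E.isOpen_dom.mem_nhds (h.subset_dom hx))
  have ha := E.smooth_a.contDiffAt (E.isOpen_dom.mem_nhds (h.subset_dom hx))
  have habs : ContDiffAt ℝ ∞ (fun y => |E.s3 y|) x :=
    (contDiffAt_abs (h.s3_ne_zero hx)).comp x h3
  exact (ha.div (habs.rpow_const_of_ne (abs_pos.2 (h.s3_ne_zero hx)).ne')
    (Real.rpow_pos_of_pos (abs_pos.2 (h.s3_ne_zero hx)) _).ne').contDiffWithinAt

theorem contDiffOn_J1 (h : E.RegularOn Δ) : ContDiffOn ℝ ∞ E.J1 Δ :=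
  ((E.contDiffOn_s5.mono h.subset_dom).pow 3).div ((E.contDiffOn_s3.mono h.subset_dom).pow 5)
    fun _ hx => pow_ne_zero _ (h.s3_ne_zero hx)

theorem contDiffOn_nabla_J1 (h : E.RegularOn Δ) : ContDiffOn ℝ ∞ (E.nabla E.J1) Δ :=
  h.contDiffOn_weight.mul (h.contDiffOn_J1.deriv_of_isOpen h.isOpen (by simp))

theorem contDiffOn_sigmaMap (h : E.RegularOn Δ) : ContDiffOn ℝ ∞ E.sigmaMap Δ :=
  h.contDiffOn_J1.prodMk h.contDiffOn_nabla_J1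

theorem continuousAt_sigmaMap (h : E.RegularOn Δ) {x : ℝ} (hx : x ∈ Δ) :
    ContinuousAt E.sigmaMap x :=
  (h.contDiffOn_sigmaMap.contDiffAt (h.isOpen.mem_nhds hx)).continuousAt

theorem sigmaMap_mem {x : ℝ} (hx : x ∈ Δ) : E.sigmaMap x ∈ E.sigmaCurve Δ := ⟨x, hx, rfl⟩

/-- The interior of the fibre over `p` is open, relatively closed in Δ by `hloc`, and nonempty once
a critical point exists. It would then contain Δ, shrinking the curve to a point. -/
theorem deriv_comp_ne_zero_of_eventually_const (h : E.RegularOn Δ) {φ : ℝ × ℝ → ℝ} {p : ℝ × ℝ}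
    (hφ : ContDiff ℝ ∞ φ) (hc : IsLocalCoordinateAt φ (E.sigmaCurve Δ) p)
    (hloc : ∀ y ∈ Δ, E.sigmaMap y = p → deriv (φ ∘ E.sigmaMap) y = 0 →
      ∀ᶠ z in 𝓝 y, E.sigmaMap z = p)
    {x : ℝ} (hx : x ∈ Δ) (hp : E.sigmaMap x = p) : deriv (φ ∘ E.sigmaMap) x ≠ 0 := by
  intro h0
  set u : Set ℝ := interior {y | E.sigmaMap y = p}
  have hu : ∀ z ∈ u, E.sigmaMap z = p := fun z hz =>
    (interior_subset hz : z ∈ {y | E.sigmaMap y = p})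
  have hψ : ContDiffOn ℝ ∞ (φ ∘ E.sigmaMap) Δ := hφ.comp_contDiffOn h.contDiffOn_sigmaMap
  have hψ' : ContDiffOn ℝ ∞ (deriv (φ ∘ E.sigmaMap)) Δ := hψ.deriv_of_isOpen h.isOpen (by simp)
  have hsub : Δ ⊆ u := by
    refine h.isOpenInterval.2.1.isPreconnected.subset_of_closure_inter_subset isOpen_interior
      ⟨x, hx, mem_interior_iff_mem_nhds.2 (hloc x hx hp h0)⟩ ?_
    rintro y ⟨hyc, hy⟩
    rw [mem_closure_iff_frequently] at hyc
    -- At a limit point of `u`, both `σ = p` and the vanishing of the derivative persist by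
    -- continuity.
    refine mem_interior_iff_mem_nhds.2 (hloc y hy ?_ ?_)
    · by_contra hne
      exact hyc (((h.continuousAt_sigmaMap hy).eventually_ne hne).mono
        fun z hz hzu => hz (hu z hzu))
    · by_contra hne
      refine hyc ((((hψ'.contDiffAt (h.isOpen.mem_nhds hy)).continuousAt).eventually_ne hne).mono
        fun z hz hzu => hz ?_)
      have : φ ∘ E.sigmaMap =ᶠ[𝓝 z] fun _ => φ p := by
        filter_upwards [mem_interior_iff_mem_nhds.1 hzu] with w hw
        rw [Function.comp_apply, show E.sigmaMap w = p from hw]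
      rw [this.deriv_eq, deriv_const]
  -- The open interval `I` of coordinate values would consist of `φ p` alone.
  obtain ⟨U, I, γ, -, -, ⟨hIo, -, t, ht⟩, -, -, hI⟩ := hc
  have hall : ∀ s ∈ I, s = φ p := by
    intro s hs
    obtain ⟨⟨⟨y, hy, hyγ⟩, -⟩, hs'⟩ := hI s hs
    rw [← hs', ← hyγ, hu y (hsub hy)]
  have hn : ∀ᶠ s in 𝓝 t, s = t := by
    filter_upwards [hIo.mem_nhds ht] with s hs
    rw [hall s hs, hall t ht]
  obtain ⟨ε, hε, hb⟩ := Metric.eventually_nhds_iff.1 hn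
  have := hb (y := t + ε / 2) (by rw [Real.dist_eq, add_sub_cancel_left, abs_of_pos] <;> linarith)
  linarith

/-- If `φ` is a local coordinate, the curve is locally recovered from it. -/
theorem eventually_eq_of_coordinate (h : E.RegularOn Δ) {φ : ℝ × ℝ → ℝ} {U : Set (ℝ × ℝ)}
    {γ : ℝ → ℝ × ℝ} (hU : IsOpen U) (hγ : ∀ q ∈ E.sigmaCurve Δ ∩ U, γ (φ q) = q)
    {x : ℝ} (hx : x ∈ Δ) (hxU : E.sigmaMap x ∈ U) :
    ∀ᶠ y in 𝓝 x, E.sigmaMap y = γ (φ (E.sigmaMap y)) := by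
  filter_upwards [h.isOpen.mem_nhds hx,
    (h.continuousAt_sigmaMap hx).preimage_mem_nhds (hU.mem_nhds hxU)] with y hy hyU
  exact (hγ _ ⟨sigmaMap_mem hy, hyU⟩).symm

theorem deriv_J1_ne_zero (h : E.RegularOn Δ) {x : ℝ} (hx : x ∈ Δ)
    (hc : IsLocalCoordinateAt Prod.fst (E.sigmaCurve Δ) (E.sigmaMap x)) : deriv E.J1 x ≠ 0 := by
  refine h.deriv_comp_ne_zero_of_eventually_const (φ := Prod.fst) contDiff_fst hc ?_ hx rfl
  intro y hy hyp h0
  obtain ⟨U, I, γ, hU, hpU, ⟨hIo, -⟩, hγs, hγ, -⟩ := hc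
  rw [← hyp] at hpU ⊢
  have hev := h.eventually_eq_of_coordinate hU (fun q hq => (hγ q hq).2) hy hpU
  have hJI : E.J1 y ∈ I := (hγ _ ⟨sigmaMap_mem hy, hpU⟩).1
  have hG : DifferentiableAt ℝ (fun z => (γ z).2) (E.J1 y) :=
    (((hγs.contDiffAt (hIo.mem_nhds hJI)).snd).differentiableAt (by simp))
  have hJ : ∀ᶠ z in 𝓝 y, DifferentiableAt ℝ E.J1 z := by
    filter_upwards [h.isOpen.mem_nhds hy] with z hz
    exact (h.contDiffOn_J1.contDiffAt (h.isOpen.mem_nhds hz)).differentiableAt (by simp)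
  have h0' : deriv E.J1 y = 0 := h0
  have := eventually_const_of_deriv_eq_comp hJ
    (h.contDiffOn_weight.contDiffAt (h.isOpen.mem_nhds hy)).continuousAt (h.weight_ne_zero hy)
    (v := E.nabla E.J1) (Eventually.of_forall fun z => E.nabla_eq _ z) hG
    (hev.mono fun z hz => congrArg Prod.snd hz) (by rw [nabla_eq, h0', mul_zero])
  filter_upwards [this, hev] with z hz hz'
  rw [hz', hev.self_of_nhds]
  simp only [sigmaMap, hz]

/-- Here `J1 = G(∇ J1)`, so a critical point of `∇ J1` is one of `J1` too, and `∇ J1` vanishes there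
to first order. -/
theorem deriv_nabla_J1_ne_zero (h : E.RegularOn Δ) {x : ℝ} (hx : x ∈ Δ)
    (hc : IsLocalCoordinateAt Prod.snd (E.sigmaCurve Δ) (E.sigmaMap x)) :
    deriv (E.nabla E.J1) x ≠ 0 := by
  refine h.deriv_comp_ne_zero_of_eventually_const (φ := Prod.snd) contDiff_snd hc ?_ hx rfl
  intro y hy hyp h0
  obtain ⟨U, I, γ, hU, hpU, ⟨hIo, -⟩, hγs, hγ, -⟩ := hc
  rw [← hyp] at hpU ⊢
  have hev := h.eventually_eq_of_coordinate hU (fun q hq => (hγ q hq).2) hy hpU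
  have hI : E.nabla E.J1 y ∈ I := (hγ _ ⟨sigmaMap_mem hy, hpU⟩).1
  have hGs : ContDiffOn ℝ ∞ (fun z => (γ z).1) I := hγs.fst
  have hG : ∀ᶠ z in 𝓝 (E.nabla E.J1 y), DifferentiableAt ℝ (fun z => (γ z).1) z := by
    filter_upwards [hIo.mem_nhds hI] with z hz
    exact (hGs.contDiffAt (hIo.mem_nhds hz)).differentiableAt (by simp)
  have hG' : DifferentiableAt ℝ (deriv fun z => (γ z).1) (E.nabla E.J1 y) :=
    ((hGs.deriv_of_isOpen (m := ∞) hIo (by simp)).contDiffAt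
      (hIo.mem_nhds hI)).differentiableAt (by simp)
  have hv : ∀ᶠ z in 𝓝 y, DifferentiableAt ℝ (E.nabla E.J1) z := by
    filter_upwards [h.isOpen.mem_nhds hy] with z hz
    exact (h.contDiffOn_nabla_J1.contDiffAt (h.isOpen.mem_nhds hz)).differentiableAt (by simp)
  have h0' : deriv (E.nabla E.J1) y = 0 := h0
  have hJG : ∀ᶠ z in 𝓝 y, E.J1 z = (fun z => (γ z).1) (E.nabla E.J1 z) :=
    hev.mono fun z hz => congrArg Prod.fst hz
  have hJ0 : deriv E.J1 y = 0 := by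
    rw [EventuallyEq.deriv_eq hJG]
    have := (hG.self_of_nhds.hasDerivAt.comp y hv.self_of_nhds.hasDerivAt).deriv
    rw [h0', mul_zero] at this
    exact this
  have hv0 : E.nabla E.J1 y = 0 := by rw [nabla_eq, hJ0, mul_zero]
  have := eventually_eq_zero_of_eq_comp hv
    ((h.contDiffOn_nabla_J1.deriv_of_isOpen (m := ∞) h.isOpen (by simp)).contDiffAt
      (h.isOpen.mem_nhds hy)).continuousAt
    (h.contDiffOn_weight.contDiffAt (h.isOpen.mem_nhds hy)).continuousAt (h.weight_ne_zero hy)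
    (Eventually.of_forall fun z => E.nabla_eq _ z) hG hG' hJG hv0 h0'
  filter_upwards [this, hev] with z hz hz'
  rw [hz', hev.self_of_nhds]
  simp only [sigmaMap, hz, hv0]

/-- A coordinate function among `j₁`, `j₁₁`, smooth and restricting to an immersion. -/
theorem exists_coordinate (h : E.RegularOn Δ) {x : ℝ} (hx : x ∈ Δ) :
    ∃ φ : ℝ × ℝ → ℝ, ContDiff ℝ ∞ φ ∧ IsLocalCoordinateAt φ (E.sigmaCurve Δ) (E.sigmaMap x) ∧
      deriv (φ ∘ E.sigmaMap) x ≠ 0 := by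
  rcases h.localCoordinate _ (sigmaMap_mem hx) with hc | hc
  · exact ⟨Prod.fst, contDiff_fst, hc, h.deriv_J1_ne_zero hx hc⟩
  · exact ⟨Prod.snd, contDiff_snd, hc, h.deriv_nabla_J1_ne_zero hx hc⟩

/-- `J1` may have critical points when only `j₁₁` is a coordinate, but they are isolated, so
identities obtained by dividing by `∇ J1` extend across them by continuity. -/
theorem eventually_nabla_J1_ne_zero (h : E.RegularOn Δ) {x : ℝ} (hx : x ∈ Δ) :
    ∀ᶠ y in 𝓝[≠] x, E.nabla E.J1 y ≠ 0 := by
  have hd : DifferentiableAt ℝ (E.nabla E.J1) x :=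
    (h.contDiffOn_nabla_J1.contDiffAt (h.isOpen.mem_nhds hx)).differentiableAt (by simp)
  rcases h.localCoordinate _ (sigmaMap_mem hx) with hc | hc
  · have : E.nabla E.J1 x ≠ 0 := by
      rw [nabla_eq]
      exact mul_ne_zero (h.weight_ne_zero hx) (h.deriv_J1_ne_zero hx hc)
    exact (hd.continuousAt.eventually_ne this).filter_mono nhdsWithin_le_nhds
  · exact hd.hasDerivAt.eventually_ne (h.deriv_nabla_J1_ne_zero hx hc)

/-- The image of a neighbourhood of `x` is a neighbourhood of `σ(x)` in the curve. -/
theorem eventually_mem_image (h : E.RegularOn Δ) {x : ℝ} (hx : x ∈ Δ) {N : Set ℝ}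
    (hN : N ∈ 𝓝 x) :
    ∀ᶠ q in 𝓝 (E.sigmaMap x), q ∈ E.sigmaCurve Δ → q ∈ E.sigmaMap '' N := by
  obtain ⟨φ, hφ, ⟨U, I, γ, hU, hpU, -, -, hγ, -⟩, hne⟩ := h.exists_coordinate hx
  have hev := h.eventually_eq_of_coordinate hU (fun q hq => (hγ q hq).2) hx hpU
  have hs : HasStrictDerivAt (φ ∘ E.sigmaMap) (deriv (φ ∘ E.sigmaMap) x) x :=
    ((hφ.comp_contDiffOn h.contDiffOn_sigmaMap).contDiffAt
      (h.isOpen.mem_nhds hx)).hasStrictDerivAt (by simp)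
  have hmap := hs.map_nhds_eq hne
  -- A nonzero strict derivative makes `φ ∘ σ` open at `x`. Since `φ` is injective on the curve
  -- within `U`, any curve point near σ(x) is attained in `N`, even if σ returns there from
  -- elsewhere in Δ.
  have himg : (φ ∘ E.sigmaMap) '' (N ∩ {y | E.sigmaMap y = γ (φ (E.sigmaMap y))}) ∈
      𝓝 (φ (E.sigmaMap x)) := by
    have := image_mem_map (m := φ ∘ E.sigmaMap) (inter_mem hN hev)
    rwa [hmap] at this
  filter_upwards [hU.mem_nhds hpU, hφ.continuous.continuousAt.preimage_mem_nhds himg]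
    with q hqU hq hqS
  obtain ⟨y, ⟨hyN, hy⟩, hyq⟩ := hq
  refine ⟨y, hyN, ?_⟩
  rw [show E.sigmaMap y = _ from hy, show φ (E.sigmaMap y) = φ q from hyq, (hγ q ⟨hqS, hqU⟩).2]

end RegularOn

end AbelODE

/-! ### Transformation of coefficients and invariants -/

namespace AbelODE

/-- The transformation rules of the coefficients under `x ↦ f(x)`, `y ↦ g(x) y + h(x)`. -/
def CoeffRel (f g h : ℝ → ℝ) (E₁ E₂ : AbelODE) (x : ℝ) : Prop :=
  E₁.a x = E₂.a (f x) * g x ^ 2 * deriv f x ∧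
  E₁.b x = deriv f x * g x * (3 * E₂.a (f x) * h x + E₂.b (f x)) ∧
  deriv g x + g x * E₁.c x = deriv f x *
    (3 * E₂.a (f x) * g x * h x ^ 2 + 2 * E₂.b (f x) * g x * h x + E₂.c (f x) * g x) ∧
  deriv h x + g x * E₁.d x = deriv f x *
    (E₂.a (f x) * h x ^ 3 + E₂.b (f x) * h x ^ 2 + E₂.c (f x) * h x + E₂.d (f x))

theorem map_eq_iff_coeffRel {f g h : ℝ → ℝ} {E₁ E₂ : AbelODE} {x : ℝ} (hf : deriv f x ≠ 0)
    (hg : g x ≠ 0) :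
    (∀ y p : ℝ, p = E₁.rhs x y ↔
      (deriv g x * y + g x * p + deriv h x) / deriv f x = E₂.rhs (f x) (g x * y + h x)) ↔
    CoeffRel f g h E₁ E₂ x := by
  constructor
  · intro hm
    have key := fun y => (div_eq_iff hf).1 ((hm y _).1 rfl)
    simp only [rhs] at key
    obtain ⟨e3, e2, e1, e0⟩ := cubic_coeff_eq
      (p₃ := g x * E₁.a x) (p₂ := g x * E₁.b x) (p₁ := deriv g x + g x * E₁.c x)
      (p₀ := deriv h x + g x * E₁.d x)
      (q₃ := deriv f x * (E₂.a (f x) * g x ^ 3))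
      (q₂ := deriv f x * (3 * E₂.a (f x) * g x ^ 2 * h x + E₂.b (f x) * g x ^ 2))
      (q₁ := deriv f x *
        (3 * E₂.a (f x) * g x * h x ^ 2 + 2 * E₂.b (f x) * g x * h x + E₂.c (f x) * g x))
      (q₀ := deriv f x *
        (E₂.a (f x) * h x ^ 3 + E₂.b (f x) * h x ^ 2 + E₂.c (f x) * h x + E₂.d (f x)))
      (fun y => by linear_combination key y)
    -- The `y³` and `y²` coefficients carry a common factor `g`, cancelled here.
    refine ⟨mul_left_cancel₀ hg ?_, mul_left_cancel₀ hg ?_, e1, e0⟩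
    · linear_combination e3
    · linear_combination e2
  · rintro ⟨e3, e2, e1, e0⟩ y p
    rw [div_eq_iff hf, ← mul_right_inj' hg (b := p)]
    simp only [rhs]
    constructor <;> intro hp
    · linear_combination hp + g x * y ^ 3 * e3 + g x * y ^ 2 * e2 + y * e1 + e0
    · linear_combination hp - g x * y ^ 3 * e3 - g x * y ^ 2 * e2 - y * e1 - e0

theorem differentiableAt_a (E : AbelODE) {x : ℝ} (hx : x ∈ E.dom) : DifferentiableAt ℝ E.a x :=
  (E.smooth_a.contDiffAt (E.isOpen_dom.mem_nhds hx)).differentiableAt (by simp)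

theorem differentiableAt_b (E : AbelODE) {x : ℝ} (hx : x ∈ E.dom) : DifferentiableAt ℝ E.b x :=
  (E.smooth_b.contDiffAt (E.isOpen_dom.mem_nhds hx)).differentiableAt (by simp)

theorem differentiableAt_s3 (E : AbelODE) {x : ℝ} (hx : x ∈ E.dom) : DifferentiableAt ℝ E.s3 x :=
  (E.contDiffOn_s3.contDiffAt (E.isOpen_dom.mem_nhds hx)).differentiableAt (by simp)

section Derivatives

variable {E₁ E₂ : AbelODE} {f g h : ℝ → ℝ} {x : ℝ}

/-- This and the next two lemmas assume only one local rule each, so they also serve while a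
transformation is still being constructed. -/
theorem deriv_a_of_eventually (hx : f x ∈ E₂.dom) (hf : DifferentiableAt ℝ f x)
    (hf' : DifferentiableAt ℝ (deriv f) x) (hg : DifferentiableAt ℝ g x)
    (ha : ∀ᶠ y in 𝓝 x, E₁.a y = E₂.a (f y) * g y ^ 2 * deriv f y) :
    deriv E₁.a x = deriv E₂.a (f x) * deriv f x * g x ^ 2 * deriv f x +
      E₂.a (f x) * (2 * g x * deriv g x * deriv f x + g x ^ 2 * deriv (deriv f) x) := by
  have hA : HasDerivAt (fun y => E₂.a (f y)) (deriv E₂.a (f x) * deriv f x) x :=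
    (E₂.differentiableAt_a hx).hasDerivAt.comp x hf.hasDerivAt
  rw [EventuallyEq.deriv_eq ha]
  refine ((hA.fun_mul (hg.hasDerivAt.fun_pow 2)).fun_mul hf'.hasDerivAt).deriv.trans ?_
  push_cast
  ring

theorem deriv_b_of_eventually (hx : f x ∈ E₂.dom) (hf : DifferentiableAt ℝ f x)
    (hf' : DifferentiableAt ℝ (deriv f) x) (hg : DifferentiableAt ℝ g x)
    (hh : DifferentiableAt ℝ h x)
    (hb : ∀ᶠ y in 𝓝 x, E₁.b y = deriv f y * g y * (3 * E₂.a (f y) * h y + E₂.b (f y))) :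
    deriv E₁.b x = deriv (deriv f) x * g x * (3 * E₂.a (f x) * h x + E₂.b (f x))
      + deriv f x * deriv g x * (3 * E₂.a (f x) * h x + E₂.b (f x))
      + deriv f x * g x * (3 * (deriv E₂.a (f x) * deriv f x) * h x
        + 3 * E₂.a (f x) * deriv h x + deriv E₂.b (f x) * deriv f x) := by
  have hA : HasDerivAt (fun y => E₂.a (f y)) (deriv E₂.a (f x) * deriv f x) x :=
    (E₂.differentiableAt_a hx).hasDerivAt.comp x hf.hasDerivAt
  have hB : HasDerivAt (fun y => E₂.b (f y)) (deriv E₂.b (f x) * deriv f x) x :=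
    (E₂.differentiableAt_b hx).hasDerivAt.comp x hf.hasDerivAt
  rw [EventuallyEq.deriv_eq hb]
  refine ((hf'.hasDerivAt.fun_mul hg.hasDerivAt).fun_mul
    (((hA.const_mul 3).fun_mul hh.hasDerivAt).fun_add hB)).deriv.trans ?_
  ring

theorem deriv_s3_of_eventually (hx : f x ∈ E₂.dom) (hf : DifferentiableAt ℝ f x)
    (hf' : DifferentiableAt ℝ (deriv f) x) (hg : DifferentiableAt ℝ g x)
    (hs : ∀ᶠ y in 𝓝 x, E₁.s3 y = (g y * deriv f y) ^ 3 * E₂.s3 (f y)) :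
    deriv E₁.s3 x = 3 * (g x * deriv f x) ^ 2
        * (deriv g x * deriv f x + g x * deriv (deriv f) x) * E₂.s3 (f x)
      + (g x * deriv f x) ^ 3 * (deriv E₂.s3 (f x) * deriv f x) := by
  have hS : HasDerivAt (fun y => E₂.s3 (f y)) (deriv E₂.s3 (f x) * deriv f x) x :=
    (E₂.differentiableAt_s3 hx).hasDerivAt.comp x hf.hasDerivAt
  rw [EventuallyEq.deriv_eq hs]
  refine (((hg.hasDerivAt.fun_mul hf'.hasDerivAt).fun_pow 3).fun_mul hS).deriv.trans ?_
  push_cast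
  ring

end Derivatives

/-- The coefficient relations for `c` and `d` follow from those for `a`, `b`, `s₃` and `s₅`. -/
theorem abel_coeff_of_invariants
    {a a' b b' c d s' A A' B B' C D S S' F F' g g' h h' : ℝ}
    (hg : g ≠ 0) (hF : F ≠ 0) (hA : A ≠ 0) (hS : S ≠ 0)
    (ha : a = A * g ^ 2 * F)
    (ha' : a' = A' * F * g ^ 2 * F + A * (2 * g * g' * F + g ^ 2 * F'))
    (hb : b = F * g * (3 * A * h + B))
    (hb' : b' = F' * g * (3 * A * h + B) + F * g' * (3 * A * h + B)
      + F * g * (3 * (A' * F) * h + 3 * A * h' + B' * F))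
    (hSd : S = A' * B - B' * A + A * B * C - 2 / 9 * B ^ 3 - 3 * A ^ 2 * D)
    (hs3 : a' * b - b' * a + a * b * c - 2 / 9 * b ^ 3 - 3 * a ^ 2 * d = (g * F) ^ 3 * S)
    (hs' : s' = 3 * (g * F) ^ 2 * (g' * F + g * F') * S + (g * F) ^ 3 * (S' * F))
    (hs5 : a * s' - 3 * ((g * F) ^ 3 * S) * (a' + a * c - 1 / 3 * b ^ 2) =
      (g * F) ^ 5 * (A * S' - 3 * S * (A' + A * C - 1 / 3 * B ^ 2))) :
    g' + g * c = F * (3 * A * g * h ^ 2 + 2 * B * g * h + C * g) ∧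
    h' + g * d = F * (A * h ^ 3 + B * h ^ 2 + C * h + D) := by
  have hc : g' + g * c = F * (3 * A * g * h ^ 2 + 2 * B * g * h + C * g) := by
    -- `c₀` is the value that the rule prescribes. It yields the same `s5` as `c`, and `c` enters
    -- `s5` linearly with coefficient `-3 a s₃ ≠ 0`.
    obtain ⟨c₀, hc₀⟩ : ∃ c₀, g' + g * c₀ = F * (3 * A * g * h ^ 2 + 2 * B * g * h + C * g) :=
      ⟨(F * (3 * A * g * h ^ 2 + 2 * B * g * h + C * g) - g') / g, by field_simp; ring⟩
    have h5 := abel_s5_transform ha ha' hb hc₀ rfl hs'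
    have hane : a ≠ 0 := by rw [ha]; positivity
    have hk : 3 * ((g * F) ^ 3 * S) * a ≠ 0 := by positivity
    have : c = c₀ := mul_left_cancel₀ hk (by linear_combination h5 - hs5)
    rw [this, hc₀]
  refine ⟨hc, ?_⟩
  -- The same argument for `d`, whose coefficient in `s3` is `-3 a²`.
  obtain ⟨d₀, hd₀⟩ : ∃ d₀, h' + g * d₀ = F * (A * h ^ 3 + B * h ^ 2 + C * h + D) :=
    ⟨(F * (A * h ^ 3 + B * h ^ 2 + C * h + D) - h') / g, by field_simp; ring⟩
  have h3 := abel_s3_transform ha ha' hb hb' hc hd₀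
  rw [← hSd] at h3
  have hane : a ≠ 0 := by rw [ha]; positivity
  have hk : 3 * a ^ 2 ≠ 0 := by positivity
  have : d = d₀ := mul_left_cancel₀ hk (by linear_combination h3 - hs3)
  rw [this, hd₀]

namespace Carries

variable {f g h : ℝ → ℝ} {D : Set ℝ} {E₁ E₂ : AbelODE}

theorem isOpen (H : Carries f g h D E₁ E₂) : IsOpen D := H.isOpenInterval.1

theorem coeffRel (H : Carries f g h D E₁ E₂) {x : ℝ} (hx : x ∈ D) : CoeffRel f g h E₁ E₂ x :=
  (map_eq_iff_coeffRel (H.deriv_f_ne_zero x hx) (H.g_ne_zero x hx)).1 (H.map_eq x hx)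

theorem differentiableAt_f (H : Carries f g h D E₁ E₂) {x : ℝ} (hx : x ∈ D) :
    DifferentiableAt ℝ f x :=
  (H.smooth_f.contDiffAt (H.isOpen.mem_nhds hx)).differentiableAt (by simp)

theorem differentiableAt_deriv_f (H : Carries f g h D E₁ E₂) {x : ℝ} (hx : x ∈ D) :
    DifferentiableAt ℝ (deriv f) x :=
  ((H.smooth_f.deriv_of_isOpen (m := ∞) H.isOpen (by simp)).contDiffAt
    (H.isOpen.mem_nhds hx)).differentiableAt (by simp)

theorem differentiableAt_g (H : Carries f g h D E₁ E₂) {x : ℝ} (hx : x ∈ D) :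
    DifferentiableAt ℝ g x :=
  (H.smooth_g.contDiffAt (H.isOpen.mem_nhds hx)).differentiableAt (by simp)

theorem differentiableAt_h (H : Carries f g h D E₁ E₂) {x : ℝ} (hx : x ∈ D) :
    DifferentiableAt ℝ h x :=
  (H.smooth_h.contDiffAt (H.isOpen.mem_nhds hx)).differentiableAt (by simp)

theorem deriv_a_eq (H : Carries f g h D E₁ E₂) {x : ℝ} (hx : x ∈ D) :
    deriv E₁.a x = deriv E₂.a (f x) * deriv f x * g x ^ 2 * deriv f x +
      E₂.a (f x) * (2 * g x * deriv g x * deriv f x + g x ^ 2 * deriv (deriv f) x) := by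
  refine deriv_a_of_eventually (H.mapsTo_dom hx) (H.differentiableAt_f hx)
    (H.differentiableAt_deriv_f hx) (H.differentiableAt_g hx) ?_
  filter_upwards [H.isOpen.mem_nhds hx] with y hy using (H.coeffRel hy).1

theorem s3_eq (H : Carries f g h D E₁ E₂) {x : ℝ} (hx : x ∈ D) :
    E₁.s3 x = (g x * deriv f x) ^ 3 * E₂.s3 (f x) := by
  obtain ⟨ha, hb, hc, hd⟩ := H.coeffRel hx
  refine abel_s3_transform ha (H.deriv_a_eq hx) hb (deriv_b_of_eventually (H.mapsTo_dom hx)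
    (H.differentiableAt_f hx) (H.differentiableAt_deriv_f hx) (H.differentiableAt_g hx)
    (H.differentiableAt_h hx) ?_) hc hd
  filter_upwards [H.isOpen.mem_nhds hx] with y hy using (H.coeffRel hy).2.1

theorem s5_eq (H : Carries f g h D E₁ E₂) {x : ℝ} (hx : x ∈ D) :
    E₁.s5 x = (g x * deriv f x) ^ 5 * E₂.s5 (f x) := by
  obtain ⟨ha, hb, hc, -⟩ := H.coeffRel hx
  refine abel_s5_transform ha (H.deriv_a_eq hx) hb hc (H.s3_eq hx)
    (deriv_s3_of_eventually (H.mapsTo_dom hx) (H.differentiableAt_f hx)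
      (H.differentiableAt_deriv_f hx) (H.differentiableAt_g hx) ?_)
  filter_upwards [H.isOpen.mem_nhds hx] with y hy using H.s3_eq hy

theorem J1_eq (H : Carries f g h D E₁ E₂) {x : ℝ} (hx : x ∈ D) : E₁.J1 x = E₂.J1 (f x) := by
  have hk : (g x * deriv f x) ≠ 0 := mul_ne_zero (H.g_ne_zero x hx) (H.deriv_f_ne_zero x hx)
  have h15 : (g x * deriv f x) ^ 15 ≠ 0 := pow_ne_zero _ hk
  rw [J1, J1, H.s5_eq hx, H.s3_eq hx, mul_pow _ (E₂.s5 _), mul_pow _ (E₂.s3 _), ← pow_mul,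
    ← pow_mul, mul_div_mul_left _ _ h15]

/-- `s1` gains `g² f'` and `|s3|^(2/3)` gains `(g f')²`, whatever the sign of `g f'`; the quotient
gains `1 / f'`. -/
theorem weight_eq (H : Carries f g h D E₁ E₂) {x : ℝ} (hx : x ∈ D) :
    E₁.weight x * deriv f x = E₂.weight (f x) := by
  have hg := H.g_ne_zero x hx
  have hf := H.deriv_f_ne_zero x hx
  have habs : |(g x * deriv f x) ^ 3| ^ (2 / 3 : ℝ) = (g x * deriv f x) ^ 2 := by
    rw [abs_pow, ← Real.rpow_natCast, ← Real.rpow_mul (abs_nonneg _), ← sq_abs (g x * deriv f x)]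
    norm_num
  rw [weight, weight, s1, s1, H.s3_eq hx, abs_mul, Real.mul_rpow (abs_nonneg _) (abs_nonneg _),
    habs, (H.coeffRel hx).1, div_mul_eq_mul_div,
    ← mul_div_mul_left (E₂.a (f x)) _ (pow_ne_zero 2 (mul_ne_zero hg hf))]
  congr 1
  ring

theorem sigmaMap_eq (H : Carries f g h D E₁ E₂) {x : ℝ} (hx : x ∈ D)
    (hJ : DifferentiableAt ℝ E₂.J1 (f x)) : E₁.sigmaMap x = E₂.sigmaMap (f x) := by
  have hev : ∀ᶠ y in 𝓝 x, E₁.J1 y = E₂.J1 (f y) := by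
    filter_upwards [H.isOpen.mem_nhds hx] with y hy using H.J1_eq hy
  have hd : deriv E₁.J1 x = deriv E₂.J1 (f x) * deriv f x := by
    rw [EventuallyEq.deriv_eq hev]
    exact (hJ.hasDerivAt.comp x (H.differentiableAt_f hx).hasDerivAt).deriv
  rw [sigmaMap, sigmaMap, H.J1_eq hx, nabla_eq, nabla_eq, hd, ← H.weight_eq hx]
  congr 1
  ring

end Carries

end AbelODE

/-! ### Constructing equivalences from curves -/

namespace AbelODE

variable {E₁ E₂ : AbelODE} {Δ₁ Δ₂ : Set ℝ}

/-- A smooth reparametrization matching `σ` and the invariant derivations extends to a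
transformation of the equations. -/
theorem exists_carries (h₁ : E₁.RegularOn Δ₁) (h₂ : E₂.RegularOn Δ₂) {f : ℝ → ℝ} {D : Set ℝ}
    (hD : IsOpenInterval D) (hD₁ : D ⊆ Δ₁) (hf : ContDiffOn ℝ ∞ f D) (hD₂ : MapsTo f D Δ₂)
    (hJ : ∀ x ∈ D, E₁.J1 x = E₂.J1 (f x))
    (hw : ∀ x ∈ D, E₁.weight x * deriv f x = E₂.weight (f x)) :
    ∃ g h, Carries f g h D E₁ E₂ := by
  have hDo : IsOpen D := hD.1
  have hdom₁ : D ⊆ E₁.dom := hD₁.trans h₁.subset_dom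
  have hdom₂ : MapsTo f D E₂.dom := fun x hx => h₂.subset_dom (hD₂ hx)
  have ha : ∀ x ∈ D, E₁.a x ≠ 0 := fun x hx => E₁.a_ne_zero x (hdom₁ hx)
  have hA : ∀ x ∈ D, E₂.a (f x) ≠ 0 := fun x hx => E₂.a_ne_zero _ (hdom₂ hx)
  have hs : ∀ x ∈ D, E₁.s3 x ≠ 0 := fun x hx => h₁.s3_ne_zero (hD₁ hx)
  have hS : ∀ x ∈ D, E₂.s3 (f x) ≠ 0 := fun x hx => h₂.s3_ne_zero (hD₂ hx)
  have hF : ∀ x ∈ D, deriv f x ≠ 0 := fun x hx h0 =>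
    h₂.weight_ne_zero (hD₂ hx) (by rw [← hw x hx, h0, mul_zero])
  have hf' : ContDiffOn ℝ ∞ (deriv f) D := hf.deriv_of_isOpen hDo (by simp)
  have smooth_comp : ∀ {u : ℝ → ℝ}, ContDiffOn ℝ ∞ u E₂.dom → ContDiffOn ℝ ∞ (fun x => u (f x)) D :=
    fun hu => hu.comp hf hdom₂
  -- Obtained by dividing the rule for `s3` by the rule for `a`.
  set g : ℝ → ℝ := fun x => E₁.s3 x * E₂.a (f x) / (E₂.s3 (f x) * E₁.a x * deriv f x ^ 2) with hgdef
  have hg0 : ∀ x ∈ D, g x ≠ 0 := fun x hx =>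
    div_ne_zero (mul_ne_zero (hs x hx) (hA x hx))
      (mul_ne_zero (mul_ne_zero (hS x hx) (ha x hx)) (pow_ne_zero 2 (hF x hx)))
  have hg : ContDiffOn ℝ ∞ g D :=
    ((E₁.contDiffOn_s3.mono hdom₁).mul (smooth_comp E₂.smooth_a)).div
      (((smooth_comp E₂.contDiffOn_s3).mul (E₁.smooth_a.mono hdom₁)).mul (hf'.pow 2))
      fun x hx => mul_ne_zero (mul_ne_zero (hS x hx) (ha x hx)) (pow_ne_zero 2 (hF x hx))
  set h : ℝ → ℝ := fun x => (E₁.b x / (deriv f x * g x) - E₂.b (f x)) / (3 * E₂.a (f x)) with hhdef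
  have hh : ContDiffOn ℝ ∞ h D :=
    (((E₁.smooth_b.mono hdom₁).div (hf'.mul hg)
      fun x hx => mul_ne_zero (hF x hx) (hg0 x hx)).sub (smooth_comp E₂.smooth_b)).div
      (contDiffOn_const.mul (smooth_comp E₂.smooth_a))
      fun x hx => mul_ne_zero three_ne_zero (hA x hx)
  -- The rules for `a` and `s3` overdetermine `g`; their compatibility condition is the cube of the
  -- matching `hw` of derivations.
  have hcube : ∀ x ∈ D, E₁.a x ^ 3 * deriv f x ^ 3 * E₂.s3 (f x) ^ 2 =
      E₂.a (f x) ^ 3 * E₁.s3 x ^ 2 := fun x hx => by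
    rw [← weight_cube (hs x hx), ← weight_cube (hS x hx), ← hw x hx]
    ring
  have hra : ∀ x ∈ D, E₁.a x = E₂.a (f x) * g x ^ 2 * deriv f x := fun x hx => by
    have := hcube x hx
    have h1 := ha x hx
    have h2 := hS x hx
    have h3 := hF x hx
    simp only [hgdef]
    field_simp
    linear_combination this
  have hrs : ∀ x ∈ D, E₁.s3 x = (g x * deriv f x) ^ 3 * E₂.s3 (f x) := fun x hx => by
    have := hcube x hx
    have h1 := ha x hx
    have h2 := hS x hx
    have h3 := hF x hx
    have h4 := hs x hx
    simp only [hgdef]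
    field_simp
    linear_combination this
  have hrb : ∀ x ∈ D, E₁.b x = deriv f x * g x * (3 * E₂.a (f x) * h x + E₂.b (f x)) :=
    fun x hx => by
      have h1 := hg0 x hx
      have h2 := hF x hx
      have h3 := hA x hx
      simp only [hhdef]
      field_simp
      ring
  have hrs5 : ∀ x ∈ D, E₁.s5 x = (g x * deriv f x) ^ 5 * E₂.s5 (f x) := fun x hx => by
    have h0 := hJ x hx
    have hk := mul_ne_zero (hg0 x hx) (hF x hx)
    have hS' := hS x hx
    rw [J1, J1, hrs x hx, div_eq_div_iff (by positivity) (by positivity)] at h0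
    -- `J1` sees only `s5³`; real cubing is injective, so the sign of `s5` is not lost.
    refine (Odd.strictMono_pow (n := 3) (by decide)).injective ?_
    refine mul_right_cancel₀ (pow_ne_zero 5 hS') ?_
    linear_combination h0
  have diff : ∀ {u : ℝ → ℝ}, ContDiffOn ℝ ∞ u D → ∀ x ∈ D, DifferentiableAt ℝ u x :=
    fun hu x hx => (hu.contDiffAt (hDo.mem_nhds hx)).differentiableAt (by simp)
  refine ⟨g, h, ⟨hD, hdom₁, hdom₂, hf, hg, hh, hF, hg0, fun x hx => ?_⟩⟩
  refine (map_eq_iff_coeffRel (hF x hx) (hg0 x hx)).2 ⟨hra x hx, hrb x hx, ?_⟩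
  have near : ∀ {P : ℝ → Prop}, (∀ y ∈ D, P y) → ∀ᶠ y in 𝓝 x, P y := fun hP => by
    filter_upwards [hDo.mem_nhds hx] with y hy using hP y hy
  have hs5 := hrs5 x hx
  rw [s5, hrs x hx] at hs5
  exact abel_coeff_of_invariants (hg0 x hx) (hF x hx) (hA x hx) (hS x hx) (hra x hx)
    (deriv_a_of_eventually (hdom₂ hx) (diff hf x hx) (diff hf' x hx) (diff hg x hx) (near hra))
    (hrb x hx)
    (deriv_b_of_eventually (hdom₂ hx) (diff hf x hx) (diff hf' x hx) (diff hg x hx) (diff hh x hx)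
      (near hrb)) rfl (hrs x hx)
    (deriv_s3_of_eventually (hdom₂ hx) (diff hf x hx) (diff hf' x hx) (diff hg x hx) (near hrs))
    hs5

/-- If the curves coincide near a common point, the parametrizations differ by a smooth change of
the independent variable. -/
theorem exists_reparametrization (h₁ : E₁.RegularOn Δ₁) (h₂ : E₂.RegularOn Δ₂) {x₁ x₂ : ℝ}
    (hx₁ : x₁ ∈ Δ₁) (hx₂ : x₂ ∈ Δ₂) (hσ : E₁.sigmaMap x₁ = E₂.sigmaMap x₂)
    (hsub : ∀ᶠ q in 𝓝 (E₁.sigmaMap x₁), q ∈ E₁.sigmaCurve Δ₁ → q ∈ E₂.sigmaCurve Δ₂) :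
    ∃ f : ℝ → ℝ, f x₁ = x₂ ∧ ∀ᶠ x in 𝓝 x₁,
      ContDiffAt ℝ ∞ f x ∧ f x ∈ Δ₂ ∧ E₁.sigmaMap x = E₂.sigmaMap (f x) := by
  obtain ⟨φ, hφ, ⟨U, I, γ, hU, hpU, -, -, hγ, -⟩, hne⟩ := h₂.exists_coordinate hx₂
  have hγ' : ∀ q ∈ E₂.sigmaCurve Δ₂ ∩ U, γ (φ q) = q := fun q hq => (hγ q hq).2
  have hev := h₂.eventually_eq_of_coordinate hU hγ' hx₂ hpU
  have hψ₂ : ContDiffOn ℝ ∞ (φ ∘ E₂.sigmaMap) Δ₂ := hφ.comp_contDiffOn h₂.contDiffOn_sigmaMap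
  have hs : HasStrictDerivAt (φ ∘ E₂.sigmaMap) (deriv (φ ∘ E₂.sigmaMap) x₂) x₂ :=
    (hψ₂.contDiffAt (h₂.isOpen.mem_nhds hx₂)).hasStrictDerivAt (by simp)
  set e := (hs.hasStrictFDerivAt_equiv hne).toOpenPartialHomeomorph (φ ∘ E₂.sigmaMap)
  have hecoe : ∀ y, e y = φ (E₂.sigmaMap y) := fun _ => rfl
  have hxe : x₂ ∈ e.source := (hs.hasStrictFDerivAt_equiv hne).mem_toOpenPartialHomeomorph_source
  have hψ : φ (E₁.sigmaMap x₁) = e x₂ := by rw [hσ, hecoe]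
  have hfx : e.symm (φ (E₁.sigmaMap x₁)) = x₂ := by rw [hψ, e.left_inv hxe]
  have hσc := h₁.continuousAt_sigmaMap hx₁
  have hψc : ContinuousAt (fun x => φ (E₁.sigmaMap x)) x₁ := hφ.continuous.continuousAt.comp hσc
  have htgt : φ (E₁.sigmaMap x₁) ∈ e.target := by rw [hψ]; exact e.map_source hxe
  have hfc : ContinuousAt (fun x => e.symm (φ (E₁.sigmaMap x))) x₁ :=
    ContinuousAt.comp (g := e.symm) (e.continuousAt_symm htgt) hψc
  have hfev : ∀ {P : ℝ → Prop}, (∀ᶠ y in 𝓝 x₂, P y) →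
      ∀ᶠ x in 𝓝 x₁, P (e.symm (φ (E₁.sigmaMap x))) := fun {P} hP => by
    refine hfc.eventually (p := P) ?_
    simpa only [hfx] using hP
  have hdne : ∀ᶠ y in 𝓝 x₂, deriv (φ ∘ E₂.sigmaMap) y ≠ 0 :=
    ((hψ₂.deriv_of_isOpen (m := ∞) h₂.isOpen (by simp)).contDiffAt
      (h₂.isOpen.mem_nhds hx₂)).continuousAt.eventually_ne hne
  -- In the coordinate φ, `f` is the local inverse of `φ ∘ σ₂` composed with `φ ∘ σ₁`; agreement in
  -- φ means agreement on the second curve.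
  refine ⟨fun x => e.symm (φ (E₁.sigmaMap x)), hfx, ?_⟩
  filter_upwards [h₁.isOpen.mem_nhds hx₁, hψc.eventually (e.open_target.mem_nhds htgt),
    hfev (h₂.isOpen.mem_nhds hx₂), hfev hdne, hfev hev, hσc.eventually hsub,
    hσc.eventually (hU.mem_nhds (hσ ▸ hpU))] with x hx hxt hf₂ hd hfγ hS hxU
  have hd₂ := hψ₂.contDiffAt (h₂.isOpen.mem_nhds hf₂)
  have hri : φ (E₂.sigmaMap (e.symm (φ (E₁.sigmaMap x)))) = φ (E₁.sigmaMap x) := e.right_inv hxt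
  refine ⟨?_, hf₂, ?_⟩
  · exact (e.contDiffAt_symm_deriv hd hxt (hd₂.differentiableAt (by simp)).hasDerivAt hd₂).comp x
      ((hφ.comp_contDiffOn h₁.contDiffOn_sigmaMap).contDiffAt (h₁.isOpen.mem_nhds hx))
  · rw [hfγ, hri]
    exact (hγ' _ ⟨hS ⟨x, hx, rfl⟩, hxU⟩).symm

theorem equivalentAt_of_curves (h₁ : E₁.RegularOn Δ₁) (h₂ : E₂.RegularOn Δ₂) {x₁ x₂ : ℝ}
    (hx₁ : x₁ ∈ Δ₁) (hx₂ : x₂ ∈ Δ₂) (hσ : E₁.sigmaMap x₁ = E₂.sigmaMap x₂)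
    (hsub : ∀ᶠ q in 𝓝 (E₁.sigmaMap x₁), q ∈ E₁.sigmaCurve Δ₁ → q ∈ E₂.sigmaCurve Δ₂) :
    EquivalentAt E₁ x₁ E₂ x₂ := by
  obtain ⟨f, hfx, hev⟩ := exists_reparametrization h₁ h₂ hx₁ hx₂ hσ hsub
  obtain ⟨ε, hε, hball⟩ := Metric.eventually_nhds_iff_ball.1
    (hev.and (h₁.isOpen.mem_nhds hx₁))
  set D := Metric.ball x₁ ε
  have hDo : IsOpen D := Metric.isOpen_ball
  have hD : IsOpenInterval D :=
    ⟨hDo, (convex_ball x₁ ε).ordConnected, ⟨x₁, Metric.mem_ball_self hε⟩⟩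
  have hD₁ : D ⊆ Δ₁ := fun x hx => (hball x hx).2
  have hD₂ : MapsTo f D Δ₂ := fun x hx => (hball x hx).1.2.1
  have hf : ContDiffOn ℝ ∞ f D := fun x hx => (hball x hx).1.1.contDiffWithinAt
  have hJ : ∀ x ∈ D, E₁.J1 x = E₂.J1 (f x) := fun x hx => congrArg Prod.fst (hball x hx).1.2.2
  have hv : ∀ x ∈ D, E₁.nabla E₁.J1 x = E₂.nabla E₂.J1 (f x) := fun x hx =>
    congrArg Prod.snd (hball x hx).1.2.2
  -- Compare `∇ J1` on both sides with the chain rule for `J1 = J1 ∘ f` and cancel the derivative of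
  -- `E₂.J1` at `f x`.
  have hw : ∀ x ∈ D, E₁.nabla E₁.J1 x ≠ 0 → E₁.weight x * deriv f x = E₂.weight (f x) := by
    intro x hx hne
    have hd : deriv E₁.J1 x = deriv E₂.J1 (f x) * deriv f x := by
      have : ∀ᶠ y in 𝓝 x, E₁.J1 y = E₂.J1 (f y) := by
        filter_upwards [hDo.mem_nhds hx] with y hy using hJ y hy
      rw [EventuallyEq.deriv_eq this]
      exact (((h₂.contDiffOn_J1.contDiffAt (h₂.isOpen.mem_nhds (hD₂ hx))).differentiableAt
        (by simp)).hasDerivAt.comp x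
        ((hball x hx).1.1.differentiableAt (by simp)).hasDerivAt).deriv
    have h0 := hv x hx
    rw [h0, nabla_eq] at hne
    rw [nabla_eq, nabla_eq, hd] at h0
    refine mul_right_cancel₀ (right_ne_zero_of_mul hne) ?_
    linear_combination h0
  have hw' : ∀ x ∈ D, E₁.weight x * deriv f x = E₂.weight (f x) := by
    intro x hx
    have hc₁ : ContinuousAt (fun y => E₁.weight y * deriv f y) x :=
      (h₁.contDiffOn_weight.contDiffAt (h₁.isOpen.mem_nhds (hD₁ hx))).continuousAt.mul
        ((hf.deriv_of_isOpen (m := ∞) hDo (by simp)).contDiffAt (hDo.mem_nhds hx)).continuousAt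
    have hc₂ : ContinuousAt (fun y => E₂.weight (f y)) x :=
      ContinuousAt.comp (g := E₂.weight)
        (h₂.contDiffOn_weight.contDiffAt (h₂.isOpen.mem_nhds (hD₂ hx))).continuousAt
        (hball x hx).1.1.continuousAt
    refine tendsto_nhds_unique_of_eventuallyEq (hc₁.tendsto.mono_left nhdsWithin_le_nhds)
      (hc₂.tendsto.mono_left (nhdsWithin_le_nhds (s := {x}ᶜ))) ?_
    filter_upwards [h₁.eventually_nabla_J1_ne_zero (hD₁ hx),
      nhdsWithin_le_nhds (hDo.mem_nhds hx)] with y hy hyD using hw y hyD hy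
  obtain ⟨g, h, H⟩ := exists_carries h₁ h₂ hD hD₁ hf hD₂ hJ hw'
  exact ⟨D, f, g, h, Metric.mem_ball_self hε, hfx, H⟩

/-! ### Curves of equivalent equations -/

theorem sigmaMap_eq_of_equivalentAt (h₂ : E₂.RegularOn Δ₂) {x₁ x₂ : ℝ}
    (hx₂ : x₂ ∈ Δ₂) (H : EquivalentAt E₁ x₁ E₂ x₂) : E₁.sigmaMap x₁ = E₂.sigmaMap x₂ := by
  obtain ⟨D, f, g, h, hxD, rfl, H⟩ := H
  exact H.sigmaMap_eq hxD
    ((h₂.contDiffOn_J1.contDiffAt (h₂.isOpen.mem_nhds hx₂)).differentiableAt (by simp))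

/-- σ₁(N) = σ₂(f(N)) for a small neighbourhood `N` of `x₁`, and by `eventually_mem_image` these arcs
fill both curves near the common point. -/
theorem curves_eventuallyEq_of_equivalentAt (h₁ : E₁.RegularOn Δ₁) (h₂ : E₂.RegularOn Δ₂)
    {x₁ x₂ : ℝ} (hx₁ : x₁ ∈ Δ₁) (hx₂ : x₂ ∈ Δ₂) (H : EquivalentAt E₁ x₁ E₂ x₂) :
    ∀ᶠ q in 𝓝 (E₁.sigmaMap x₁), q ∈ E₁.sigmaCurve Δ₁ ↔ q ∈ E₂.sigmaCurve Δ₂ := by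
  have hσ := sigmaMap_eq_of_equivalentAt h₂ hx₂ H
  obtain ⟨D, f, g, h, hxD, rfl, H⟩ := H
  have hfa := H.smooth_f.contDiffAt (H.isOpen.mem_nhds hxD)
  set N := D ∩ Δ₁ ∩ f ⁻¹' Δ₂
  have hN : N ∈ 𝓝 x₁ := inter_mem (inter_mem (H.isOpen.mem_nhds hxD) (h₁.isOpen.mem_nhds hx₁))
    (hfa.continuousAt.preimage_mem_nhds (h₂.isOpen.mem_nhds hx₂))
  have hNσ : ∀ y ∈ N, E₁.sigmaMap y = E₂.sigmaMap (f y) := fun y hy => H.sigmaMap_eq hy.1.1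
    ((h₂.contDiffOn_J1.contDiffAt (h₂.isOpen.mem_nhds hy.2)).differentiableAt (by simp))
  have hfN : f '' N ∈ 𝓝 (f x₁) := by
    rw [← (hfa.hasStrictDerivAt (by simp)).map_nhds_eq (H.deriv_f_ne_zero x₁ hxD)]
    exact image_mem_map hN
  have e₂ := h₂.eventually_mem_image hx₂ hfN
  rw [← hσ] at e₂
  filter_upwards [h₁.eventually_mem_image hx₁ hN, e₂] with q q₁ q₂
  constructor
  · intro hq
    obtain ⟨y, hy, rfl⟩ := q₁ hq
    exact ⟨f y, hy.2, (hNσ y hy).symm⟩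
  · intro hq
    obtain ⟨-, ⟨y, hy, rfl⟩, rfl⟩ := q₂ hq
    exact ⟨y, hy.1.2, hNσ y hy⟩

end AbelODE

end

theorem theorem3 (E₁ E₂ : AbelODE) (Δ₁ Δ₂ : Set ℝ)
    (h₁ : E₁.RegularOn Δ₁) (h₂ : E₂.RegularOn Δ₂) :
    (AbelODE.LocallyEquivalent E₁ Δ₁ E₂ Δ₂ ↔ E₁.sigmaCurve Δ₁ = E₂.sigmaCurve Δ₂) ∧
    (∀ x₁ ∈ Δ₁, ∀ x₂ ∈ Δ₂,
      AbelODE.EquivalentAt E₁ x₁ E₂ x₂ ↔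
        E₁.sigmaMap x₁ = E₂.sigmaMap x₂ ∧
        ∃ U : Set (ℝ × ℝ), IsOpen U ∧ E₁.sigmaMap x₁ ∈ U ∧
          E₁.sigmaCurve Δ₁ ∩ U = E₂.sigmaCurve Δ₂ ∩ U) := by
  refine ⟨⟨fun H => ?_, fun H => ⟨?_, ?_⟩⟩, fun x₁ hx₁ x₂ hx₂ => ⟨fun H => ?_, ?_⟩⟩
  · refine Set.Subset.antisymm ?_ ?_
    · rintro - ⟨x₁, hx₁, rfl⟩
      obtain ⟨x₂, hx₂, hE⟩ := H.1 x₁ hx₁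
      exact ⟨x₂, hx₂, (AbelODE.sigmaMap_eq_of_equivalentAt h₂ hx₂ hE).symm⟩
    · rintro - ⟨x₂, hx₂, rfl⟩
      obtain ⟨x₁, hx₁, hE⟩ := H.2 x₂ hx₂
      exact ⟨x₁, hx₁, AbelODE.sigmaMap_eq_of_equivalentAt h₂ hx₂ hE⟩
  · intro x₁ hx₁
    obtain ⟨x₂, hx₂, hσ⟩ : E₁.sigmaMap x₁ ∈ E₂.sigmaCurve Δ₂ := H ▸ ⟨x₁, hx₁, rfl⟩
    exact ⟨x₂, hx₂, AbelODE.equivalentAt_of_curves h₁ h₂ hx₁ hx₂ hσ.symm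
      (Filter.Eventually.of_forall fun q hq => H ▸ hq)⟩
  · intro x₂ hx₂
    obtain ⟨x₁, hx₁, hσ⟩ : E₂.sigmaMap x₂ ∈ E₁.sigmaCurve Δ₁ := H ▸ ⟨x₂, hx₂, rfl⟩
    exact ⟨x₁, hx₁, AbelODE.equivalentAt_of_curves h₁ h₂ hx₁ hx₂ hσ
      (Filter.Eventually.of_forall fun q hq => H ▸ hq)⟩
  · refine ⟨AbelODE.sigmaMap_eq_of_equivalentAt h₂ hx₂ H, ?_⟩
    obtain ⟨U, hU, hUo, hpU⟩ := eventually_nhds_iff.1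
      (AbelODE.curves_eventuallyEq_of_equivalentAt h₁ h₂ hx₁ hx₂ H)
    refine ⟨U, hUo, hpU, Set.ext fun q => ?_⟩
    simp only [Set.mem_inter_iff]
    exact and_congr_left fun hq => hU q hq
  · rintro ⟨hσ, U, hUo, hpU, hU⟩
    refine AbelODE.equivalentAt_of_curves h₁ h₂ hx₁ hx₂ hσ ?_
    filter_upwards [hUo.mem_nhds hpU] with q hqU hq
    exact (hU ▸ (⟨hq, hqU⟩ : q ∈ E₁.sigmaCurve Δ₁ ∩ U) : q ∈ E₂.sigmaCurve Δ₂ ∩ U).1
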